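/- **Conventions.** All monoidal categories are strict. A symmetric category is a strict monoidal category $(\mathcal C,\otimes,\mathbf I)$ with a natural family of isomorphisms $c_{V,W}:V\otimes W\to W\otimes V$ satisfying $c_{V,W\otimes U}=(\mathrm{Id}_W\otimes c_{V,U})\circ(c_{V,W}\otimes \mathrm{Id}_U)$, $c_{V\otimes W,U}=(c_{V,U}\otimes \mathrm{Id}_W)\circ(\mathrm{Id}_V\otimes c_{W,U})$ and $c_{W,V}\circ c_{V,W}=\mathrm{Id}_{V\otimes W}$. A strict symmetric functor is a functor preserving $\otimes$, $\mathbf I$ and $c$ on the nose. A braided object of a monoidal category is an object $V$ together with an invertible morphism $\sigma_V:V\otimes V\to V\otimes V$ such that $$(\sigma_V\otimes \mathrm{Id}_V)\circ(\mathrm{Id}_V\otimes\sigma_V)\circ(\sigma_V\otimes \mathrm{Id}_V)=(\mathrm{Id}_V\otimes\sigma_V)\circ(\sigma_V\otimes \mathrm{Id}_V)\circ(\mathrm{Id}_V\otimes\sigma_V).$$ For $n\ge 0$ let $VB_n$ be the virtual braid group, i.e. the group generated by $\sigma_i,\zeta_i$ $(1\le i\le n-1)$ subject to * $\sigma_i\sigma_j=\sigma_j\sigma_i$,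 $\zeta_i\zeta_j=\zeta_j\zeta_i$, $\sigma_i\zeta_j=\zeta_j\sigma_i$ for $|i-j|>1$; * $\sigma_i\sigma_{i+1}\sigma_i=\sigma_{i+1}\sigma_i\sigma_{i+1}$, $\zeta_i\zeta_{i+1}\zeta_i=\zeta_{i+1}\zeta_i\zeta_{i+1}$, $\zeta_i\zeta_{i+1}\sigma_i=\sigma_{i+1}\zeta_i\zeta_{i+1}$ for $1\le i\le n-2$; * $\zeta_i^2=1$ for $1\le i\le n-1$. Let $\mathcal C_{2br}$ be the free symmetric category generated by a single braided object $(V,\sigma_V)$: its objects are the tensor powers $V^{\otimes n}$, $n\ge 0$, and its morphisms are generated under composition and $\otimes$ by identities, the symmetric braiding $c$ and $\sigma_V^{\pm1}$, modulo exactly the axioms of a (strict) symmetric category and of a braided object. **Theorem.** The category $\mathcal C_{2br}$ with $(V,\sigma_V)$ has the universal property of the free symmetric category on a braided object: for every symmetric category $\mathcal D$ and every braided object $(W,\sigma_W)$ of $\mathcal D$ there is exactly one strict symmetric functor $\mathcal C_{2br}\to\mathcal D$ sending $V$ to $W$ and $\sigma_V$ to $\sigma_W$. Moreover, for every $n\ge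 0$ there is a group isomorphism $$\psi_{virt}: VB_n\stackrel{\sim}{\longrightarrow}\operatorname{End}_{\mathcal C_{2br}}(V^{\otimes n})$$ such that, for all $1\le i\le n-1$, $$\psi_{virt}(\zeta_i)=\mathrm{Id}_V^{\otimes(i-1)}\otimes c_{V,V}\otimes \mathrm{Id}_V^{\otimes(n-i-1)},\qquad \psi_{virt}(\sigma_i^{\pm1})=\mathrm{Id}_V^{\otimes(i-1)}\otimes \sigma_V^{\pm1}\otimes \mathrm{Id}_V^{\otimes(n-i-1)}.$$ Multiplication in $\operatorname{End}_{\mathcal C_{2br}}(V^{\otimes n})$ is composition of morphisms. -/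

import Mathlib

open CategoryTheory MonoidalCategory

set_option linter.unusedSectionVars false
set_option linter.unusedSimpArgs false

universe u v u' v'

namespace VirtualBraid

/-! ### Virtual braid groups -/

/-- The generators of the virtual braid group on `n` strands. The index `i : Fin (n - 1)` is
zero-based: `σ i` and `ζ i` involve the strands `i + 1` and `i + 2` among `1, …, n`. -/
inductive Gen (n : ℕ) : Type
  | σ (i : Fin (n - 1)) : Gen n
  | ζ (i : Fin (n - 1)) : Gen n

/-- The defining relations of the virtual braid group, `Rel a b` meaning `a = b`. -/
inductive Rel (n : ℕ) : FreeGroup (Gen n) → FreeGroup (Gen n) → Prop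
  | σ_comm (i j : Fin (n - 1)) (h : 1 < |(i : ℤ) - (j : ℤ)|) :
      Rel n (.of (.σ i) * .of (.σ j)) (.of (.σ j) * .of (.σ i))
  | σ_yb (i j : Fin (n - 1)) (h : (j : ℕ) = i + 1) :
      Rel n (.of (.σ i) * .of (.σ j) * .of (.σ i)) (.of (.σ j) * .of (.σ i) * .of (.σ j))
  | ζ_comm (i j : Fin (n - 1)) (h : 1 < |(i : ℤ) - (j : ℤ)|) :
      Rel n (.of (.ζ i) * .of (.ζ j)) (.of (.ζ j) * .of (.ζ i))
  | ζ_yb (i j : Fin (n - 1)) (h : (j : ℕ) = i + 1) :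
      Rel n (.of (.ζ i) * .of (.ζ j) * .of (.ζ i)) (.of (.ζ j) * .of (.ζ i) * .of (.ζ j))
  | ζ_sq (i : Fin (n - 1)) : Rel n (.of (.ζ i) * .of (.ζ i)) 1
  | mixed_comm (i j : Fin (n - 1)) (h : 1 < |(i : ℤ) - (j : ℤ)|) :
      Rel n (.of (.σ i) * .of (.ζ j)) (.of (.ζ j) * .of (.σ i))
  | mixed_yb (i j : Fin (n - 1)) (h : (j : ℕ) = i + 1) :
      Rel n (.of (.ζ i) * .of (.ζ j) * .of (.σ i)) (.of (.σ j) * .of (.ζ i) * .of (.ζ j))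

/-- The virtual braid group `VB_n`. -/
abbrev VB (n : ℕ) : Type :=
  PresentedGroup {w : FreeGroup (Gen n) | ∃ a b, Rel n a b ∧ w = a * b⁻¹}

/-- The generator `σ_i` of `VB_n`. -/
def VB.σ {n : ℕ} (i : Fin (n - 1)) : VB n := PresentedGroup.of (Gen.σ i)

/-- The generator `ζ_i` of `VB_n`. -/
def VB.ζ {n : ℕ} (i : Fin (n - 1)) : VB n := PresentedGroup.of (Gen.ζ i)

/-! ### Strict monoidal categories, braided objects, strict symmetric functors -/

/-- A monoidal category is strict if its associators and unitors are identities. -/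
class StrictMonoidal (C : Type u) [Category.{v} C] [MonoidalCategory C] : Prop where
  tensor_assoc : ∀ X Y Z : C, (X ⊗ Y) ⊗ Z = X ⊗ (Y ⊗ Z)
  unit_tensor : ∀ X : C, 𝟙_ C ⊗ X = X
  tensor_unit : ∀ X : C, X ⊗ 𝟙_ C = X
  associator_eq : ∀ X Y Z : C, α_ X Y Z = eqToIso (tensor_assoc X Y Z)
  leftUnitor_eq : ∀ X : C, λ_ X = eqToIso (unit_tensor X)
  rightUnitor_eq : ∀ X : C, ρ_ X = eqToIso (tensor_unit X)

/-- A braided object of a monoidal category: an object `V` with a specific braiding, i.e. an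
invertible `σ : V ⊗ V ⟶ V ⊗ V` satisfying the Yang-Baxter equation. -/
structure BraidedObject (C : Type u) [Category.{v} C] [MonoidalCategory C] where
  V : C
  σ : V ⊗ V ≅ V ⊗ V
  yang_baxter :
    σ.hom ▷ V ≫ (α_ V V V).hom ≫ V ◁ σ.hom ≫ (α_ V V V).inv ≫ σ.hom ▷ V ≫ (α_ V V V).hom =
      (α_ V V V).hom ≫ V ◁ σ.hom ≫ (α_ V V V).inv ≫ σ.hom ▷ V ≫ (α_ V V V).hom ≫ V ◁ σ.hom

/-- A functor is strict symmetric if it preserves the unit, the tensor product and the braiding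
on the nose. -/
structure StrictSymmetric {C : Type u} [Category.{v} C] [MonoidalCategory C] [SymmetricCategory C]
    {D : Type u'} [Category.{v'} D] [MonoidalCategory D] [SymmetricCategory D]
    (F : C ⥤ D) : Prop where
  obj_unit : F.obj (𝟙_ C) = 𝟙_ D
  obj_tensor : ∀ X Y : C, F.obj (X ⊗ Y) = F.obj X ⊗ F.obj Y
  map_tensor : ∀ {X X' Y Y' : C} (f : X ⟶ X') (g : Y ⟶ Y'),
    F.map (f ⊗ₘ g) =
      eqToHom (obj_tensor X Y) ≫ (F.map f ⊗ₘ F.map g) ≫ eqToHom (obj_tensor X' Y').symm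
  map_braiding : ∀ X Y : C,
    F.map (β_ X Y).hom =
      eqToHom (obj_tensor X Y) ≫ (β_ (F.obj X) (F.obj Y)).hom ≫ eqToHom (obj_tensor Y X).symm

/-- The functor `F` sends the braided object `A` to the braided object `B`. -/
def SendsTo {C : Type u} [Category.{v} C] [MonoidalCategory C]
    {D : Type u'} [Category.{v'} D] [MonoidalCategory D]
    (F : C ⥤ D) (A : BraidedObject C) (B : BraidedObject D) : Prop :=
  ∃ (_ : F.obj A.V = B.V) (h : F.obj (A.V ⊗ A.V) = B.V ⊗ B.V),
    F.map A.σ.hom = eqToHom h ≫ B.σ.hom ≫ eqToHom h.symm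

/-- The strict symmetric category `C` is free on its braided object `A`: for every braided
object `B` of a strict symmetric category there is exactly one strict symmetric functor that sends
`A` to `B`. -/
def IsFreeOn (C : Type u) [Category.{v} C] [MonoidalCategory C] [SymmetricCategory C]
    [StrictMonoidal C] (A : BraidedObject C) : Prop :=
  ∀ (D : Type u') [Category.{v'} D] [MonoidalCategory D] [SymmetricCategory D] [StrictMonoidal D]
    (B : BraidedObject D), ∃! F : C ⥤ D, StrictSymmetric F ∧ SendsTo F A B

/-! ### Tensor powers and endomorphisms acting on two neighbouring factors -/

section Powers

variable {C : Type u} [Category.{v} C] [MonoidalCategory C]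

/-- The tensor power `V^{⊗ n}`. -/
def tensorPow (V : C) : ℕ → C
  | 0 => 𝟙_ C
  | n + 1 => tensorPow V n ⊗ V

theorem tensorPow_one [StrictMonoidal C] (V : C) : tensorPow V 1 = V :=
  StrictMonoidal.unit_tensor V

theorem tensorPow_add [StrictMonoidal C] (V : C) (m n : ℕ) :
    tensorPow V (m + n) = tensorPow V m ⊗ tensorPow V n := by
  induction n with
  | zero => exact (StrictMonoidal.tensor_unit _).symm
  | succ n ih =>
    change tensorPow V (m + n) ⊗ V = _ ⊗ (tensorPow V n ⊗ V)
    rw [ih, StrictMonoidal.tensor_assoc]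

theorem tensorPow_two [StrictMonoidal C] (V : C) : tensorPow V (1 + 1) = V ⊗ V := by
  rw [tensorPow_add, tensorPow_one]

theorem tensorPow_split [StrictMonoidal C] (V : C) {n : ℕ} (i : Fin (n - 1)) :
    tensorPow V n = tensorPow V i ⊗ ((V ⊗ V) ⊗ tensorPow V (n - i - 2)) := by
  rw [← tensorPow_two, ← tensorPow_add, ← tensorPow_add]
  congr 1
  have := i.isLt
  omega

/-- `Id_V^{⊗ i} ⊗ φ ⊗ Id_V^{⊗ (n - i - 2)}` as an endomorphism of `V^{⊗ n}`, for zero-based `i`. -/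
def insertAt [StrictMonoidal C] {V : C} (φ : V ⊗ V ⟶ V ⊗ V) {n : ℕ} (i : Fin (n - 1)) :
    End (tensorPow V n) :=
  eqToHom (tensorPow_split V i) ≫
    (𝟙 (tensorPow V i) ⊗ₘ (φ ⊗ₘ 𝟙 (tensorPow V (n - i - 2)))) ≫
      eqToHom (tensorPow_split V i).symm

end Powers

/-! ### The free symmetric category on one braided object, by generators and relations -/

/-- Formal morphisms `V^{⊗ m} ⟶ V^{⊗ n}` of the free symmetric category. The constructor `cast`
is the identity of `V^{⊗ m}`, seen as a morphism to `V^{⊗ n}` if `m = n`; `braid` is the symmetric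
braiding `c`, and `sig`, `sigInv` are the specific braiding and its inverse. -/
inductive FHom : ℕ → ℕ → Type
  | cast {m n : ℕ} (h : m = n) : FHom m n
  | comp {l m n : ℕ} (f : FHom l m) (g : FHom m n) : FHom l n
  | tensor {m n m' n' : ℕ} (f : FHom m n) (g : FHom m' n') : FHom (m + m') (n + n')
  | braid (m n : ℕ) : FHom (m + n) (n + m)
  | sig : FHom (1 + 1) (1 + 1)
  | sigInv : FHom (1 + 1) (1 + 1)

namespace FHom

/-- The formal identity. -/
abbrev id (n : ℕ) : FHom n n := cast rfl

/-- The formal associator, an identity morphism. -/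
abbrev assoc (l m n : ℕ) : FHom (l + m + n) (l + (m + n)) := cast (Nat.add_assoc l m n)

/-- The inverse of the formal associator. -/
abbrev assocInv (l m n : ℕ) : FHom (l + (m + n)) (l + m + n) := cast (Nat.add_assoc l m n).symm

end FHom

open FHom in
/-- The congruence on formal morphisms generated by the axioms of a strict symmetric category
and of a braided object. -/
inductive FEquiv : ∀ {m n : ℕ}, FHom m n → FHom m n → Prop
  | refl {m n} (f : FHom m n) : FEquiv f f
  | symm {m n} {f g : FHom m n} : FEquiv f g → FEquiv g f
  | trans {m n} {f g h : FHom m n} : FEquiv f g → FEquiv g h → FEquiv f h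
  | comp {l m n} {f f' : FHom l m} {g g' : FHom m n} :
      FEquiv f f' → FEquiv g g' → FEquiv (f.comp g) (f'.comp g')
  | tensor {m n m' n'} {f f' : FHom m n} {g g' : FHom m' n'} :
      FEquiv f f' → FEquiv g g' → FEquiv (f.tensor g) (f'.tensor g')
  | id_comp {m n} (f : FHom m n) : FEquiv ((FHom.id m).comp f) f
  | comp_id {m n} (f : FHom m n) : FEquiv (f.comp (FHom.id n)) f
  | comp_assoc {k l m n} (f : FHom k l) (g : FHom l m) (h : FHom m n) :
      FEquiv ((f.comp g).comp h) (f.comp (g.comp h))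
  | tensor_id (m n : ℕ) : FEquiv ((FHom.id m).tensor (FHom.id n)) (FHom.id (m + n))
  | tensor_comp {l m n l' m' n'} (f : FHom l m) (g : FHom m n) (f' : FHom l' m')
      (g' : FHom m' n') :
      FEquiv ((f.tensor f').comp (g.tensor g')) ((f.comp g).tensor (f'.comp g'))
  | tensor_assoc {m n m' n' m'' n''} (f : FHom m n) (g : FHom m' n') (h : FHom m'' n'') :
      FEquiv (((f.tensor g).tensor h).comp (assoc n n' n''))
        ((assoc m m' m'').comp (f.tensor (g.tensor h)))
  | unit_tensor {m n} (f : FHom m n) :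
      FEquiv (((FHom.id 0).tensor f).comp (cast (Nat.zero_add n)))
        ((cast (Nat.zero_add m)).comp f)
  | tensor_unit {m n} (f : FHom m n) :
      FEquiv ((f.tensor (FHom.id 0)).comp (cast (Nat.add_zero n)))
        ((cast (Nat.add_zero m)).comp f)
  | braid_natural {m n m' n'} (f : FHom m n) (g : FHom m' n') :
      FEquiv ((f.tensor g).comp (braid n n')) ((braid m m').comp (g.tensor f))
  | hexagon_forward (l m n : ℕ) :
      FEquiv ((assoc l m n).comp ((braid l (m + n)).comp (assoc m n l)))
        (((braid l m).tensor (FHom.id n)).comp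
          ((assoc m l n).comp ((FHom.id m).tensor (braid l n))))
  | hexagon_reverse (l m n : ℕ) :
      FEquiv ((assocInv l m n).comp ((braid (l + m) n).comp (assocInv n l m)))
        (((FHom.id l).tensor (braid m n)).comp
          ((assocInv l n m).comp ((braid l n).tensor (FHom.id m))))
  | symmetry (m n : ℕ) : FEquiv ((braid m n).comp (braid n m)) (FHom.id (m + n))
  | sig_sigInv : FEquiv (sig.comp sigInv) (FHom.id (1 + 1))
  | sigInv_sig : FEquiv (sigInv.comp sig) (FHom.id (1 + 1))
  | yang_baxter :
      FEquiv
        ((sig.tensor (FHom.id 1)).comp ((assoc 1 1 1).comp (((FHom.id 1).tensor sig).comp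
          ((assocInv 1 1 1).comp ((sig.tensor (FHom.id 1)).comp (assoc 1 1 1))))))
        ((assoc 1 1 1).comp (((FHom.id 1).tensor sig).comp ((assocInv 1 1 1).comp
          ((sig.tensor (FHom.id 1)).comp ((assoc 1 1 1).comp ((FHom.id 1).tensor sig))))))

instance fSetoid (m n : ℕ) : Setoid (FHom m n) := ⟨FEquiv, FEquiv.refl, FEquiv.symm, FEquiv.trans⟩

/-- The free symmetric category `C_{2br}` on one braided object. The object `⟨n⟩` is the `n`-th
tensor power of the generating object. -/
structure C2br : Type where
  of ::
  len : ℕ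

namespace C2br

instance : Category.{0} C2br where
  Hom X Y := Quotient (fSetoid X.len Y.len)
  id X := ⟦FHom.id X.len⟧
  comp := Quotient.map₂ FHom.comp (fun _ _ hf _ _ hg => FEquiv.comp hf hg)
  id_comp := by
    rintro X Y ⟨f⟩
    exact Quotient.sound (FEquiv.id_comp f)
  comp_id := by
    rintro X Y ⟨f⟩
    exact Quotient.sound (FEquiv.comp_id f)
  assoc := by
    rintro W X Y Z ⟨f⟩ ⟨g⟩ ⟨h⟩
    exact Quotient.sound (FEquiv.comp_assoc f g h)

/-- The morphism represented by a formal morphism. -/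
def mk {X Y : C2br} (f : FHom X.len Y.len) : X ⟶ Y := Quotient.mk (fSetoid X.len Y.len) f

theorem mk_comp {X Y Z : C2br} (f : FHom X.len Y.len) (g : FHom Y.len Z.len) :
    mk (X := X) (Y := Z) (f.comp g) = mk (X := X) (Y := Y) f ≫ mk g := rfl

theorem mk_cast {X Y : C2br} (h : X = Y) :
    mk (X := X) (Y := Y) (FHom.cast (congrArg len h)) = eqToHom h := by
  subst h; rfl

/-- Objects of the same length are isomorphic through an identity. -/
def castIso {X Y : C2br} (h : X = Y) : X ≅ Y where
  hom := mk (FHom.cast (congrArg len h))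
  inv := mk (FHom.cast (congrArg len h.symm))
  hom_inv_id := by rw [mk_cast h, mk_cast h.symm, eqToHom_trans, eqToHom_refl]
  inv_hom_id := by rw [mk_cast h, mk_cast h.symm, eqToHom_trans, eqToHom_refl]

theorem castIso_eq {X Y : C2br} (h : X = Y) : castIso h = eqToIso h :=
  Iso.ext (mk_cast h)

instance : MonoidalCategoryStruct C2br where
  tensorObj X Y := ⟨X.len + Y.len⟩
  tensorHom := Quotient.map₂ FHom.tensor (fun _ _ hf _ _ hg => FEquiv.tensor hf hg)
  whiskerLeft X _ _ f :=
    Quotient.map₂ FHom.tensor (fun _ _ hf _ _ hg => FEquiv.tensor hf hg)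
      (Quotient.mk (fSetoid _ _) (FHom.id X.len)) f
  whiskerRight f Y :=
    Quotient.map₂ FHom.tensor (fun _ _ hf _ _ hg => FEquiv.tensor hf hg)
      f (Quotient.mk (fSetoid _ _) (FHom.id Y.len))
  tensorUnit := ⟨0⟩
  associator X Y Z := castIso (congrArg C2br.of (Nat.add_assoc X.len Y.len Z.len))
  leftUnitor X := castIso (congrArg C2br.of (Nat.zero_add X.len))
  rightUnitor X := castIso (congrArg C2br.of (Nat.add_zero X.len))

theorem mk_tensor {X Y X' Y' : C2br} (f : FHom X.len Y.len) (g : FHom X'.len Y'.len) :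
    mk (X := X ⊗ X') (Y := Y ⊗ Y') (f.tensor g) = mk (X := X) (Y := Y) f ⊗ₘ mk g := rfl

theorem castIso_tensor {A B : C2br} (h : A = B) (D : C2br) :
    (castIso h).hom ⊗ₘ 𝟙 D = eqToHom (congrArg (fun t => t ⊗ D) h) := by
  subst h
  exact Quotient.sound (FEquiv.tensor_id _ _)

theorem tensor_castIso {A B : C2br} (h : A = B) (D : C2br) :
    𝟙 D ⊗ₘ (castIso h).hom = eqToHom (congrArg (fun t => D ⊗ t) h) := by
  subst h
  exact Quotient.sound (FEquiv.tensor_id _ _)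

instance : MonoidalCategory C2br :=
  MonoidalCategory.ofTensorHom
    (id_tensorHom_id := fun X Y => Quotient.sound (FEquiv.tensor_id X.len Y.len))
    (tensorHom_comp_tensorHom := by
      rintro X₁ Y₁ Z₁ X₂ Y₂ Z₂ ⟨f₁⟩ ⟨f₂⟩ ⟨g₁⟩ ⟨g₂⟩
      exact Quotient.sound (FEquiv.tensor_comp f₁ g₁ f₂ g₂))
    (id_tensorHom := fun _ _ _ _ => rfl)
    (tensorHom_id := fun _ _ => rfl)
    (associator_naturality := by
      rintro X₁ X₂ X₃ Y₁ Y₂ Y₃ ⟨f₁⟩ ⟨f₂⟩ ⟨f₃⟩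
      exact Quotient.sound (FEquiv.tensor_assoc f₁ f₂ f₃))
    (leftUnitor_naturality := by
      rintro X Y ⟨f⟩
      exact Quotient.sound (FEquiv.unit_tensor f))
    (rightUnitor_naturality := by
      rintro X Y ⟨f⟩
      exact Quotient.sound (FEquiv.tensor_unit f))
    (pentagon := fun W X Y Z => by
      simp only [MonoidalCategoryStruct.associator]
      erw [castIso_tensor, tensor_castIso]
      simp [castIso_eq])
    (triangle := fun X Y => by
      simp only [MonoidalCategoryStruct.associator, MonoidalCategoryStruct.leftUnitor,
        MonoidalCategoryStruct.rightUnitor]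
      erw [castIso_tensor, tensor_castIso]
      simp [castIso_eq])

instance : StrictMonoidal C2br where
  tensor_assoc X Y Z := congrArg C2br.of (Nat.add_assoc X.len Y.len Z.len)
  unit_tensor X := congrArg C2br.of (Nat.zero_add X.len)
  tensor_unit X := congrArg C2br.of (Nat.add_zero X.len)
  associator_eq _ _ _ := castIso_eq _
  leftUnitor_eq _ := castIso_eq _
  rightUnitor_eq _ := castIso_eq _

instance : SymmetricCategory C2br where
  braiding X Y :=
    { hom := mk (X := X ⊗ Y) (Y := Y ⊗ X) (FHom.braid X.len Y.len)
      inv := mk (X := Y ⊗ X) (Y := X ⊗ Y) (FHom.braid Y.len X.len)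
      hom_inv_id := Quotient.sound (FEquiv.symmetry _ _)
      inv_hom_id := Quotient.sound (FEquiv.symmetry _ _) }
  braiding_naturality_right := by
    rintro X Y Z ⟨f⟩
    exact Quotient.sound (FEquiv.braid_natural (FHom.id X.len) f)
  braiding_naturality_left := by
    rintro X Y ⟨f⟩ Z
    exact Quotient.sound (FEquiv.braid_natural f (FHom.id Z.len))
  hexagon_forward X Y Z := Quotient.sound (FEquiv.hexagon_forward X.len Y.len Z.len)
  hexagon_reverse X Y Z := Quotient.sound (FEquiv.hexagon_reverse X.len Y.len Z.len)
  symmetry X Y := Quotient.sound (FEquiv.symmetry X.len Y.len)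

/-- The generating braided object `(V, σ_V)`. -/
def gen : BraidedObject C2br where
  V := ⟨1⟩
  σ :=
    { hom := mk (X := of 1 ⊗ of 1) (Y := of 1 ⊗ of 1) FHom.sig
      inv := mk (X := of 1 ⊗ of 1) (Y := of 1 ⊗ of 1) FHom.sigInv
      hom_inv_id := Quotient.sound FEquiv.sig_sigInv
      inv_hom_id := Quotient.sound FEquiv.sigInv_sig }
  yang_baxter := Quotient.sound FEquiv.yang_baxter

/-! ### The universal property -/

section Lift

variable {D : Type u'} [Category.{v'} D] [MonoidalCategory D]

theorem comp_heq' {X Y Z X' Y' Z' : D} {f : X ⟶ Y} {g : Y ⟶ Z} {f' : X' ⟶ Y'} {g' : Y' ⟶ Z'}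
    (hX : X = X') (hY : Y = Y') (hZ : Z = Z') (hf : f ≍ f') (hg : g ≍ g') :
    (f ≫ g) ≍ (f' ≫ g') := by
  subst hX hY hZ; cases hf; cases hg; rfl

theorem tensor_heq {X Y Z W X' Y' Z' W' : D} {f : X ⟶ Y} {g : Z ⟶ W} {f' : X' ⟶ Y'}
    {g' : Z' ⟶ W'} (hX : X = X') (hY : Y = Y') (hZ : Z = Z') (hW : W = W')
    (hf : f ≍ f') (hg : g ≍ g') : (f ⊗ₘ g) ≍ (f' ⊗ₘ g') := by
  subst hX hY hZ hW; cases hf; cases hg; rfl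

theorem sandwich_heq {X Y X' Y' : D} (h : X = X') (f : X' ⟶ Y') (h' : Y' = Y) :
    (eqToHom h ≫ f ≫ eqToHom h') ≍ f := by
  subst h h'; simp

theorem heq_sandwich {X Y X' Y' : D} {f : X ⟶ Y} {g : X' ⟶ Y'} (h : X = X') (h' : Y' = Y)
    (e : f ≍ g) : f = eqToHom h ≫ g ≫ eqToHom h' := by
  subst h h'; cases e; simp

theorem eqToHom_heq {X Y X' Y' : D} (h : X = Y) (h' : X' = Y') (e : X = X') :
    (eqToHom h) ≍ (eqToHom h') := by
  subst h h' e; rfl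

theorem eqToHom_heq_id {X Y Z : D} (h : X = Y) (e : X = Z) : (eqToHom h) ≍ (𝟙 Z) := by
  subst h e; rfl

theorem comp_eqToHom_heq' {X Y Z : D} (f : X ⟶ Y) (h : Y = Z) : (f ≫ eqToHom h) ≍ f := by
  subst h; simp

theorem eqToHom_comp_heq' {X Y Z : D} (f : Y ⟶ Z) (h : X = Y) : (eqToHom h ≫ f) ≍ f := by
  subst h; simp

variable [SymmetricCategory D]

theorem braiding_heq {X Y X' Y' : D} (hX : X = X') (hY : Y = Y') :
    (β_ X Y).hom ≍ (β_ X' Y').hom := by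
  subst hX hY; rfl

variable [StrictMonoidal D]

/-- Interpretation of formal morphisms in a strict symmetric category with a braided object. -/
def interp (B : BraidedObject D) : ∀ {m n : ℕ}, FHom m n → (tensorPow B.V m ⟶ tensorPow B.V n)
  | _, _, .cast h => eqToHom (congrArg (tensorPow B.V) h)
  | _, _, .comp f g => interp B f ≫ interp B g
  | _, _, .tensor f g =>
      eqToHom (tensorPow_add B.V _ _) ≫ (interp B f ⊗ₘ interp B g) ≫
        eqToHom (tensorPow_add B.V _ _).symm
  | _, _, .braid m n =>
      eqToHom (tensorPow_add B.V m n) ≫ (β_ (tensorPow B.V m) (tensorPow B.V n)).hom ≫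
        eqToHom (tensorPow_add B.V n m).symm
  | _, _, .sig =>
      eqToHom (tensorPow_two B.V) ≫ B.σ.hom ≫ eqToHom (tensorPow_two B.V).symm
  | _, _, .sigInv =>
      eqToHom (tensorPow_two B.V) ≫ B.σ.inv ≫ eqToHom (tensorPow_two B.V).symm

theorem strict_assoc_nat {X Y Z X' Y' Z' : D} (f : X ⟶ X') (g : Y ⟶ Y') (h : Z ⟶ Z') :
    ((f ⊗ₘ g) ⊗ₘ h) ≍ (f ⊗ₘ (g ⊗ₘ h)) := by
  have e := MonoidalCategory.associator_naturality f g h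
  rw [StrictMonoidal.associator_eq, StrictMonoidal.associator_eq] at e
  simp only [eqToIso.hom] at e
  exact (comp_eqToHom_heq' _ _).symm.trans ((heq_of_eq e).trans (eqToHom_comp_heq' _ _))

theorem strict_unit_tensor {X X' : D} (f : X ⟶ X') : (𝟙 (𝟙_ D) ⊗ₘ f) ≍ f := by
  have e := MonoidalCategory.leftUnitor_naturality f
  rw [StrictMonoidal.leftUnitor_eq, StrictMonoidal.leftUnitor_eq, ← id_tensorHom] at e
  simp only [eqToIso.hom] at e
  exact (comp_eqToHom_heq' _ _).symm.trans ((heq_of_eq e).trans (eqToHom_comp_heq' _ _))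

theorem strict_tensor_unit {X X' : D} (f : X ⟶ X') : (f ⊗ₘ 𝟙 (𝟙_ D)) ≍ f := by
  have e := MonoidalCategory.rightUnitor_naturality f
  rw [StrictMonoidal.rightUnitor_eq, StrictMonoidal.rightUnitor_eq, ← tensorHom_id] at e
  simp only [eqToIso.hom] at e
  exact (comp_eqToHom_heq' _ _).symm.trans ((heq_of_eq e).trans (eqToHom_comp_heq' _ _))

theorem strict_hexagon_forward (X Y Z : D) :
    (β_ X (Y ⊗ Z)).hom ≍
      (((β_ X Y).hom ⊗ₘ 𝟙 Z) ≫ eqToHom (StrictMonoidal.tensor_assoc Y X Z) ≫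
        (𝟙 Y ⊗ₘ (β_ X Z).hom)) := by
  have e := BraidedCategory.hexagon_forward X Y Z
  simp only [StrictMonoidal.associator_eq, eqToIso.hom] at e
  rw [tensorHom_id, id_tensorHom, ← e]
  exact (sandwich_heq _ _ _).symm

theorem strict_hexagon_reverse (X Y Z : D) :
    (β_ (X ⊗ Y) Z).hom ≍
      ((𝟙 X ⊗ₘ (β_ Y Z).hom) ≫ eqToHom (StrictMonoidal.tensor_assoc X Z Y).symm ≫
        ((β_ X Z).hom ⊗ₘ 𝟙 Y)) := by
  have e := BraidedCategory.hexagon_reverse X Y Z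
  simp only [StrictMonoidal.associator_eq, eqToIso.inv] at e
  rw [tensorHom_id, id_tensorHom, ← e]
  exact (sandwich_heq _ _ _).symm

theorem interp_sound (B : BraidedObject D) {m n : ℕ} {f g : FHom m n} (h : FEquiv f g) :
    interp B f = interp B g := by
  have P := tensorPow_add B.V
  have P1 := tensorPow_one B.V
  have P2 := tensorPow_two B.V
  have A := StrictMonoidal.tensor_assoc (C := D)
  induction h with
  | refl => rfl
  | symm _ ih => exact ih.symm
  | trans _ _ ih ih' => exact ih.trans ih'
  | comp _ _ ih ih' => simp only [interp, ih, ih']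
  | tensor _ _ ih ih' => simp only [interp, ih, ih']
  | id_comp => simp [interp]
  | comp_id => simp [interp]
  | comp_assoc => simp [interp]
  | tensor_id => simp [interp]
  | tensor_comp => simp [interp]
  | tensor_assoc f g h =>
    apply eq_of_heq
    simp only [interp]
    refine (comp_eqToHom_heq' _ _).trans (HEq.trans ?_ (eqToHom_comp_heq' _ _).symm)
    refine (sandwich_heq _ _ _).trans (HEq.trans ?_ (sandwich_heq _ _ _).symm)
    refine HEq.trans (tensor_heq (P _ _) (P _ _) rfl rfl (sandwich_heq _ _ _) HEq.rfl) ?_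
    refine HEq.trans ?_
      (tensor_heq rfl rfl (P _ _) (P _ _) HEq.rfl (sandwich_heq _ _ _)).symm
    exact strict_assoc_nat _ _ _
  | unit_tensor f =>
    apply eq_of_heq
    simp only [interp]
    refine (comp_eqToHom_heq' _ _).trans (HEq.trans ?_ (eqToHom_comp_heq' _ _).symm)
    exact (sandwich_heq _ _ _).trans (strict_unit_tensor _)
  | tensor_unit f =>
    apply eq_of_heq
    simp only [interp]
    refine (comp_eqToHom_heq' _ _).trans (HEq.trans ?_ (eqToHom_comp_heq' _ _).symm)
    exact (sandwich_heq _ _ _).trans (strict_tensor_unit _)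
  | braid_natural f g => simp [interp]
  | hexagon_forward l m n =>
    apply eq_of_heq
    simp only [interp]
    refine (sandwich_heq _ _ _).trans ((sandwich_heq _ _ _).trans ?_)
    refine (braiding_heq rfl (P _ _)).trans ((strict_hexagon_forward _ _ _).trans ?_)
    refine comp_heq' (by simp only [P]) (by simp only [P]) (by simp only [P, A])
      (HEq.trans ?_ (sandwich_heq _ _ _).symm)
      (comp_heq' (by simp only [P]) (by simp only [P]) (by simp only [P])
        (eqToHom_heq _ _ (by simp only [P])) (HEq.trans ?_ (sandwich_heq _ _ _).symm))
    · exact tensor_heq (P _ _).symm (P _ _).symm rfl rfl (sandwich_heq _ _ _).symm HEq.rfl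
    · exact tensor_heq rfl rfl (P _ _).symm (P _ _).symm HEq.rfl (sandwich_heq _ _ _).symm
  | hexagon_reverse l m n =>
    apply eq_of_heq
    simp only [interp]
    refine (sandwich_heq _ _ _).trans ((sandwich_heq _ _ _).trans ?_)
    refine (braiding_heq (P _ _) rfl).trans ((strict_hexagon_reverse _ _ _).trans ?_)
    refine comp_heq' (by simp only [P, A]) (by simp only [P]) (by simp only [P])
      (HEq.trans ?_ (sandwich_heq _ _ _).symm)
      (comp_heq' (by simp only [P]) (by simp only [P]) (by simp only [P])
        (eqToHom_heq _ _ (by simp only [P])) (HEq.trans ?_ (sandwich_heq _ _ _).symm))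
    · exact tensor_heq rfl rfl (P _ _).symm (P _ _).symm HEq.rfl (sandwich_heq _ _ _).symm
    · exact tensor_heq (P _ _).symm (P _ _).symm rfl rfl (sandwich_heq _ _ _).symm HEq.rfl
  | symmetry => simp [interp]
  | sig_sigInv => simp [interp]
  | sigInv_sig => simp [interp]
  | yang_baxter =>
    have yb := B.yang_baxter
    simp only [StrictMonoidal.associator_eq, eqToIso.hom, eqToIso.inv, ← tensorHom_id,
      ← id_tensorHom] at yb
    have e1 : interp B (FHom.sig.tensor (FHom.id 1)) ≍ (B.σ.hom ⊗ₘ 𝟙 B.V) :=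
      (sandwich_heq _ _ _).trans
        (tensor_heq P2 P2 P1 P1 (sandwich_heq _ _ _) (eqToHom_heq_id _ P1))
    have e2 : interp B ((FHom.id 1).tensor FHom.sig) ≍ (𝟙 B.V ⊗ₘ B.σ.hom) :=
      (sandwich_heq _ _ _).trans
        (tensor_heq P1 P1 P2 P2 (eqToHom_heq_id _ P1) (sandwich_heq _ _ _))
    have e3 : interp B (FHom.assoc 1 1 1) ≍ eqToHom (A B.V B.V B.V) :=
      eqToHom_heq _ _ (by rw [P (1 + 1) 1, P2, P1])
    have e4 : interp B (FHom.assocInv 1 1 1) ≍ eqToHom (A B.V B.V B.V).symm :=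
      eqToHom_heq _ _ (by rw [P 1 (1 + 1), P2, P1])
    have q1 : tensorPow B.V (1 + 1 + 1) = (B.V ⊗ B.V) ⊗ B.V := by rw [P (1 + 1) 1, P2, P1]
    have q2 : tensorPow B.V (1 + (1 + 1)) = B.V ⊗ (B.V ⊗ B.V) := by rw [P 1 (1 + 1), P2, P1]
    apply eq_of_heq
    refine HEq.trans
      (b := (B.σ.hom ⊗ₘ 𝟙 B.V) ≫ eqToHom (A B.V B.V B.V) ≫ (𝟙 B.V ⊗ₘ B.σ.hom) ≫
        eqToHom (A B.V B.V B.V).symm ≫ (B.σ.hom ⊗ₘ 𝟙 B.V) ≫ eqToHom (A B.V B.V B.V)) ?_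
      (HEq.trans (heq_of_eq yb) (HEq.symm ?_))
    · exact comp_heq' q1 q1 q2 e1 (comp_heq' q1 q2 q2 e3 (comp_heq' q2 q2 q2 e2
        (comp_heq' q2 q1 q2 e4 (comp_heq' q1 q1 q2 e1 e3))))
    · exact comp_heq' q1 q2 q2 e3 (comp_heq' q2 q2 q2 e2 (comp_heq' q2 q1 q2 e4
        (comp_heq' q1 q1 q2 e1 (comp_heq' q1 q2 q2 e3 e2))))

/-- The strict symmetric functor out of the free category determined by a braided object. -/
def lift (B : BraidedObject D) : C2br ⥤ D where
  obj X := tensorPow B.V X.len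
  map {X Y} f := Quotient.lift (fun p : FHom X.len Y.len => interp B p)
    (fun _ _ h => interp_sound B h) f
  map_id X := by exact eqToHom_refl _ _
  map_comp := by rintro X Y Z ⟨f⟩ ⟨g⟩; rfl

theorem lift_strictSymmetric (B : BraidedObject D) : StrictSymmetric (lift B) where
  obj_unit := rfl
  obj_tensor X Y := tensorPow_add B.V X.len Y.len
  map_tensor := by rintro X X' Y Y' ⟨f⟩ ⟨g⟩; rfl
  map_braiding X Y := rfl

theorem lift_sendsTo (B : BraidedObject D) : SendsTo (lift B) gen B :=
  ⟨tensorPow_one B.V, tensorPow_two B.V, rfl⟩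

theorem obj_eq (B : BraidedObject D) {F : C2br ⥤ D} (hF : StrictSymmetric F)
    (hB : SendsTo F gen B) : ∀ n : ℕ, F.obj (of n) = tensorPow B.V n
  | 0 => hF.obj_unit
  | n + 1 => by
    have := hF.obj_tensor (of n) (of 1)
    exact this.trans (congrArg₂ (fun a b => a ⊗ b) (obj_eq B hF hB n) hB.1)

theorem inv_heq {X X' Y Y' : D} {f : X ≅ Y} {g : X' ≅ Y'} (hX : X = X') (hY : Y = Y')
    (h : f.hom ≍ g.hom) : f.inv ≍ g.inv := by
  subst hX hY
  rw [Iso.ext (eq_of_heq h)]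

theorem map_heq (B : BraidedObject D) {F : C2br ⥤ D} (hF : StrictSymmetric F)
    (hB : SendsTo F gen B) {m n : ℕ} (f : FHom m n) :
    F.map (mk (X := of m) (Y := of n) f) ≍ interp B f := by
  have O := obj_eq B hF hB
  have hsig : F.map gen.σ.hom ≍ B.σ.hom := by
    obtain ⟨_, h, e⟩ := hB
    rw [e]
    exact sandwich_heq _ _ _
  have h2 : F.obj (gen.V ⊗ gen.V) = B.V ⊗ B.V := hB.2.1
  induction f with
  | cast h =>
    subst h
    exact (heq_of_eq (F.map_id _)).trans ((eqToHom_heq_id (D := D) rfl (O _).symm).symm)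
  | comp f g ihf ihg =>
    refine HEq.trans (heq_of_eq ?_) (comp_heq' (O _) (O _) (O _) ihf ihg)
    exact F.map_comp (mk (X := of _) (Y := of _) f) (mk (X := of _) (Y := of _) g)
  | tensor f g ihf ihg =>
    refine (heq_of_eq (hF.map_tensor (mk (X := of _) (Y := of _) f)
      (mk (X := of _) (Y := of _) g))).trans ((sandwich_heq _ _ _).trans ?_)
    exact (tensor_heq (O _) (O _) (O _) (O _) ihf ihg).trans (sandwich_heq _ _ _).symm
  | braid m n =>
    refine (heq_of_eq (hF.map_braiding (of m) (of n))).trans ((sandwich_heq _ _ _).trans ?_)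
    exact (braiding_heq (O _) (O _)).trans (sandwich_heq _ _ _).symm
  | sig => exact hsig.trans (sandwich_heq _ _ _).symm
  | sigInv =>
    refine HEq.trans ?_ (sandwich_heq _ _ _).symm
    exact inv_heq (f := F.mapIso gen.σ) (g := B.σ) h2 h2 hsig

end Lift

/-- `C2br` is the free symmetric category on the braided object `gen`. -/
theorem isFreeOn_gen : IsFreeOn.{0, 0, u', v'} C2br gen := by
  intro D _ _ _ _ B
  refine ⟨lift B, ⟨lift_strictSymmetric B, lift_sendsTo B⟩, ?_⟩
  rintro F ⟨hF, hB⟩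
  refine CategoryTheory.Functor.ext (fun X => obj_eq B hF hB X.len) ?_
  rintro X Y ⟨f⟩
  exact heq_sandwich _ _ (map_heq B hF hB f)

end C2br
end VirtualBraid

/-! The universal property is built into the presentation of `C2br` and is `C2br.isFreeOn_gen`; what
remains is to identify the endomorphisms of `V^{⊗ n}` with virtual braids.

Placing `σ_V` and `c_{V,V}` on neighbouring factors respects the relations of `VB_n`: distant
commutation is the interchange law (`place_comm`), and the Yang-Baxter relation for `ζ` and the
mixed relation are both naturality of `c` combined with a hexagon (`place_braid_slide`). This gives
the homomorphism `ofBraid`.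

It is injective because a left inverse exists: read a formal morphism as a virtual braid, sending
`c_{m,n}` to the word that permutes two blocks of strands and `⊗` to juxtaposition. The heart of the
proof is `FHom.eval_sound`, that this reading respects every axiom of the free category. Naturality
of `c` says that block words carry generators to shifted generators (`blockWord_up`,
`blockWord_down`), the hexagons are additivity of block words in each block, and the symmetry axiom
is `blockWord_symm`.

It is surjective because the hexagons reduce every `c_{m,n}` to copies of `c_{1,1}`, so that each
formal morphism is a composite of placed generators (`IsBraid.all`).

Products follow composition of maps: the rightmost factor acts first. -/

namespace VirtualBraid

/-! ### Block permutations as words in the virtual generators -/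

section Blocks

variable {G : Type*} [Group G]

/-- The sequence `x` moves through products of elements of the sequence `z` as the generators of
the virtual braid group on `N` strands move through virtual crossings. -/
structure Slides (N : ℕ) (z x : ℕ → G) : Prop where
  comm : ∀ i j, i + 1 < j ∨ j + 1 < i → z i * x j = x j * z i
  up : ∀ i, i + 2 < N → z i * (z (i + 1) * x i) = x (i + 1) * (z i * z (i + 1))
  down : ∀ i, i + 2 < N → z (i + 1) * (z i * x (i + 1)) = x i * (z (i + 1) * z i)

/-- The word moving the strand `k` across the next `n` strands. -/
def strandWord (z : ℕ → G) (k : ℕ) : ℕ → G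
  | 0 => 1
  | n + 1 => z (k + n) * strandWord z k n

/-- The word exchanging the `m` strands from `k` on with the `n` strands after them. -/
def blockWord (z : ℕ → G) (k : ℕ) : ℕ → ℕ → G
  | 0, _ => 1
  | m + 1, n => blockWord z k m n * strandWord z (k + m) n

variable {N : ℕ} {z x : ℕ → G}

theorem strandWord_comm (h : Slides N z x) (k n j : ℕ) (hj : j + 1 < k ∨ k + n < j) :
    strandWord z k n * x j = x j * strandWord z k n := by
  induction n with
  | zero => simp [strandWord]
  | succ n ih =>
    rw [strandWord, mul_assoc, ih (by omega), ← mul_assoc, h.comm _ _ (by omega), mul_assoc]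

/-- Only the crossings at `k + j` and `k + j + 1` meet `x`, and there the `down` relation applies.
The earlier crossings are far from `x (k + 1 + j)`, the later ones far from `x (k + j)`. -/
theorem strandWord_down (h : Slides N z x) (k n j : ℕ) (hj : j + 1 < n) (hN : k + n < N) :
    strandWord z k n * x (k + 1 + j) = x (k + j) * strandWord z k n := by
  induction n with
  | zero => omega
  | succ n ih =>
    rcases Nat.lt_or_ge (j + 1) n with hlt | hge
    · rw [strandWord, mul_assoc, ih hlt (by omega), ← mul_assoc, h.comm _ _ (by omega), mul_assoc]
    · obtain rfl : n = j + 1 := by omega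
      have e1 : k + 1 + j = k + j + 1 := by omega
      have c := strandWord_comm h k j (k + j + 1) (by omega)
      have d := h.down (k + j) (by omega)
      rw [strandWord, strandWord, e1, ← add_assoc, mul_assoc, mul_assoc, c]
      simp only [← mul_assoc] at d ⊢
      rw [d]

theorem blockWord_comm (h : Slides N z x) (k m n j : ℕ) (hj : j + 1 < k ∨ k + m + n ≤ j) :
    blockWord z k m n * x j = x j * blockWord z k m n := by
  induction m with
  | zero => simp [blockWord]
  | succ m ih =>
    rw [blockWord, mul_assoc, strandWord_comm h _ _ _ (by omega), ← mul_assoc, ih (by omega),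
      mul_assoc]

theorem blockWord_down (h : Slides N z x) (k m n j : ℕ) (hj : j + 1 < n) (hN : k + m + n ≤ N) :
    blockWord z k m n * x (k + m + j) = x (k + j) * blockWord z k m n := by
  induction m with
  | zero => simp [blockWord]
  | succ m ih =>
    have e : k + (m + 1) + j = k + m + 1 + j := by omega
    rw [blockWord, mul_assoc, e, strandWord_down h _ _ _ hj (by omega), ← mul_assoc,
      ih (by omega), mul_assoc]

theorem strandWord_add (z : ℕ → G) (k m n : ℕ) :
    strandWord z k (m + n) = strandWord z (k + m) n * strandWord z k m := by
  induction n with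
  | zero => simp [strandWord]
  | succ n ih => rw [← add_assoc, strandWord, ih, strandWord, mul_assoc, add_assoc]

/-- Unrolls the recursion on the first block; this is what the reverse hexagon becomes. -/
theorem blockWord_add_left (z : ℕ → G) (k l m n : ℕ) :
    blockWord z k (l + m) n = blockWord z k l n * blockWord z (k + l) m n := by
  induction m with
  | zero => simp [blockWord]
  | succ m ih => rw [← add_assoc, blockWord, ih, blockWord, mul_assoc, add_assoc]

theorem blockWord_zero_right (z : ℕ → G) (k m : ℕ) : blockWord z k m 0 = 1 := by
  induction m with
  | zero => rfl
  | succ m ih => rw [blockWord, ih, strandWord, mul_one]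

theorem blockWord_strandWord_comm (h : Slides N z z) (k m n k' n' : ℕ)
    (hk : k + m + n ≤ k') :
    blockWord z k m n * strandWord z k' n' = strandWord z k' n' * blockWord z k m n := by
  induction n' with
  | zero => simp [strandWord]
  | succ n' ih =>
    rw [strandWord, ← mul_assoc, blockWord_comm h _ _ _ _ (by omega), mul_assoc, ih, mul_assoc]

/-- The counterpart of the forward hexagon. Each strand crosses the second block in two stages, and
the stages can be regrouped because the words to be exchanged involve disjoint sets of strands. -/
theorem blockWord_add_right (h : Slides N z z) (k l m n : ℕ) :
    blockWord z k l (m + n) = blockWord z (k + m) l n * blockWord z k l m := by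
  induction l with
  | zero => simp [blockWord]
  | succ l ih =>
    have e : k + m + l = k + l + m := by omega
    have c := blockWord_strandWord_comm h k l m (k + l + m) n (by omega)
    rw [blockWord, ih, strandWord_add, blockWord, blockWord, e]
    simp only [mul_assoc]
    rw [← mul_assoc (blockWord z k l m), c, mul_assoc]

/-- The two words use the same involutions in opposite orders, so they cancel from the middle
outwards. -/
theorem blockWord_one_right_mul (hz : ∀ i, z i * z i = 1) (k n : ℕ) :
    blockWord z k n 1 * strandWord z k n = 1 := by
  induction n with
  | zero => simp [blockWord, strandWord]
  | succ n ih =>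
    rw [blockWord, strandWord, strandWord, strandWord, mul_one, add_zero, mul_assoc,
      ← mul_assoc (z _), hz, one_mul, ih]

/-- Splitting one strand off the block of size `m + 1` leaves the inductive pair in the middle; once
it cancels, the outer pair is `blockWord_one_right_mul`. -/
theorem blockWord_symm (h : Slides N z z) (hz : ∀ i, z i * z i = 1) (k m n : ℕ) :
    blockWord z k n m * blockWord z k m n = 1 := by
  induction m with
  | zero => rw [blockWord_zero_right, blockWord, one_mul]
  | succ m ih =>
    rw [blockWord_add_right h, blockWord, mul_assoc, ← mul_assoc (blockWord z k n m), ih, one_mul,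
      blockWord_one_right_mul hz]

/-- This is `blockWord_down` for exchanged block sizes, inverted by means of `blockWord_symm`. -/
theorem blockWord_up (h : Slides N z x) (h' : Slides N z z) (hz : ∀ i, z i * z i = 1)
    (k m n j : ℕ) (hj : j + 1 < m) (hN : k + m + n ≤ N) :
    blockWord z k m n * x (k + j) = x (k + n + j) * blockWord z k m n := by
  have e := blockWord_down h k n m j hj (by omega)
  rw [eq_inv_of_mul_eq_one_left (blockWord_symm h' hz k m n)] at e
  rw [inv_mul_eq_iff_eq_mul, ← mul_assoc, eq_mul_inv_iff_mul_eq] at e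
  exact e.symm

end Blocks

/-! ### Evaluation of formal morphisms in the virtual braid group -/

theorem VB.rel {n : ℕ} {a b : FreeGroup (Gen n)} (h : Rel n a b) :
    PresentedGroup.mk {w : FreeGroup (Gen n) | ∃ a b, Rel n a b ∧ w = a * b⁻¹} a =
      PresentedGroup.mk _ b :=
  PresentedGroup.mk_eq_mk_of_mul_inv_mem ⟨a, b, h, rfl⟩

/-- The generator `σ i`, or `1` if `i` is out of range. -/
def VB.sig (N i : ℕ) : VB N := if h : i < N - 1 then VB.σ ⟨i, h⟩ else 1

/-- The generator `ζ i`, or `1` if `i` is out of range. -/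
def VB.zet (N i : ℕ) : VB N := if h : i < N - 1 then VB.ζ ⟨i, h⟩ else 1

namespace VB

theorem sig_of_lt {N i : ℕ} (h : i < N - 1) : sig N i = VB.σ ⟨i, h⟩ := dif_pos h

theorem zet_of_lt {N i : ℕ} (h : i < N - 1) : zet N i = VB.ζ ⟨i, h⟩ := dif_pos h

theorem zet_sq (N i : ℕ) : zet N i * zet N i = 1 := by
  unfold zet
  split_ifs with h
  · exact VB.rel (Rel.ζ_sq ⟨i, h⟩)
  · exact one_mul 1

theorem one_lt_abs_sub {i j : ℕ} (h : i + 1 < j ∨ j + 1 < i) : 1 < |(i : ℤ) - (j : ℤ)| := by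
  rw [lt_abs]; omega

theorem sig_comm (N i j : ℕ) (hij : i + 1 < j ∨ j + 1 < i) :
    sig N i * sig N j = sig N j * sig N i := by
  unfold sig
  split_ifs with h h'
  · exact VB.rel (Rel.σ_comm ⟨i, h⟩ ⟨j, h'⟩ (one_lt_abs_sub hij))
  all_goals simp

theorem sig_braid (N i : ℕ) (h : i + 2 < N) :
    sig N i * sig N (i + 1) * sig N i = sig N (i + 1) * sig N i * sig N (i + 1) := by
  rw [sig_of_lt (show i < N - 1 by omega), sig_of_lt (show i + 1 < N - 1 by omega)]
  exact VB.rel (Rel.σ_yb _ _ rfl)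

/-- The presentation supplies only `up`; since the `ζ` are involutions, inverting `ζ_i ζ_{i+1}`
turns it into `down`. -/
theorem slides_zet_of_up {N : ℕ} {x : ℕ → VB N}
    (comm : ∀ i j, i + 1 < j ∨ j + 1 < i → zet N i * x j = x j * zet N i)
    (up : ∀ i, i + 2 < N →
      zet N i * zet N (i + 1) * x i = x (i + 1) * zet N i * zet N (i + 1)) :
    Slides N (zet N) x where
  comm := comm
  up i h := by simpa only [mul_assoc] using up i h
  down i h := by
    have e := up i h
    have hz : ∀ j, (zet N j)⁻¹ = zet N j := fun j => inv_eq_of_mul_eq_one_left (zet_sq N j)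
    rw [mul_assoc (x _), ← mul_inv_eq_iff_eq_mul] at e
    rw [← e, mul_inv_rev, hz, hz]
    simp only [← mul_assoc]
    rw [mul_assoc (zet N (i + 1)) (zet N i) (zet N i), zet_sq, mul_one, zet_sq, one_mul]

theorem slides_sig (N : ℕ) : Slides N (zet N) (sig N) := by
  refine slides_zet_of_up (fun i j hij => ?_) (fun i hi => ?_)
  · unfold sig zet
    -- An index out of range contributes the factor `1`, which commutes with everything.
    split_ifs with h h'
    · exact (VB.rel (Rel.mixed_comm ⟨j, h'⟩ ⟨i, h⟩ (one_lt_abs_sub hij.symm))).symm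
    all_goals simp
  · rw [sig_of_lt (show i < N - 1 by omega), sig_of_lt (show i + 1 < N - 1 by omega),
      zet_of_lt (show i < N - 1 by omega), zet_of_lt (show i + 1 < N - 1 by omega)]
    exact VB.rel (Rel.mixed_yb _ _ rfl)

theorem slides_zet (N : ℕ) : Slides N (zet N) (zet N) := by
  refine slides_zet_of_up (fun i j hij => ?_) (fun i hi => ?_)
  · unfold zet
    split_ifs with h h'
    · exact VB.rel (Rel.ζ_comm ⟨i, h⟩ ⟨j, h'⟩ (one_lt_abs_sub hij))
    all_goals simp
  · rw [zet_of_lt (show i < N - 1 by omega), zet_of_lt (show i + 1 < N - 1 by omega)]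
    exact VB.rel (Rel.ζ_yb _ _ rfl)

end VB

/-! ### Invariance of the evaluation under the axioms of the free category -/

namespace FHom

/-- No constructor changes the number of strands, so up to a cast every morphism is an endomorphism.
Later arguments use this to identify source and target lengths. -/
theorem len_eq : ∀ {m n : ℕ}, FHom m n → m = n
  | _, _, .cast h => h
  | _, _, .comp f g => (len_eq f).trans (len_eq g)
  | _, _, .tensor f g => congrArg₂ (· + ·) (len_eq f) (len_eq g)
  | _, _, .braid m n => Nat.add_comm m n
  | _, _, .sig => rfl
  | _, _, .sigInv => rfl

/-- The virtual braid on `N` strands represented by a formal morphism acting on the strands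
from `k` on. -/
def eval (N : ℕ) : ∀ {m n : ℕ}, ℕ → FHom m n → VB N
  | _, _, _, .cast _ => 1
  | _, _, k, .comp f g => eval N k g * eval N k f
  | _, _, k, @FHom.tensor m _ _ _ f g => eval N k f * eval N (k + m) g
  | _, _, k, .braid m n => blockWord (VB.zet N) k m n
  | _, _, k, .sig => VB.sig N k
  | _, _, k, .sigInv => (VB.sig N k)⁻¹

variable {N : ℕ}

theorem strandWord_conj {z : ℕ → VB N} {a : VB N} {k k' n : ℕ}
    (hz : ∀ j, j < n → a * z (k + j) = z (k' + j) * a) :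
    a * strandWord z k n = strandWord z k' n * a := by
  induction n with
  | zero => simp [strandWord]
  | succ n ih =>
    rw [strandWord, strandWord, ← mul_assoc, hz n (by omega), mul_assoc, mul_assoc,
      ih fun j hj => hz j (by omega)]

theorem blockWord_conj {z : ℕ → VB N} {a : VB N} {k k' m n : ℕ}
    (hz : ∀ j, j + 1 < m + n → a * z (k + j) = z (k' + j) * a) :
    a * blockWord z k m n = blockWord z k' m n * a := by
  induction m with
  | zero => simp [blockWord]
  | succ m ih =>
    rw [blockWord, blockWord, ← mul_assoc, ih fun j hj => hz j (by omega), mul_assoc, mul_assoc,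
      strandWord_conj (k' := k' + m)]
    intro j hj
    rw [add_assoc, add_assoc, hz (m + j) (by omega)]

/-- The evaluation of `f` is a word in the generators of a window of `m` strands, so an element that
shifts these generators also shifts the word. With `k = k'` this yields commutation of disjoint
morphisms; with a block word for `a` it yields naturality of the braiding. -/
theorem eval_conj {a : VB N} {m n : ℕ} (f : FHom m n) {k k' : ℕ}
    (hs : ∀ j, j + 1 < m → a * VB.sig N (k + j) = VB.sig N (k' + j) * a)
    (hz : ∀ j, j + 1 < m → a * VB.zet N (k + j) = VB.zet N (k' + j) * a) :
    a * eval N k f = eval N k' f * a := by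
  induction f generalizing k k' with
  | cast => simp [eval]
  | comp f g ihf ihg =>
    obtain rfl := len_eq f
    rw [eval, eval, ← mul_assoc, ihg hs hz, mul_assoc, ihf hs hz, mul_assoc]
  | @tensor m _ m' _ f g ihf ihg =>
    rw [eval, eval, ← mul_assoc, ihf (fun j hj => hs j (by omega)) (fun j hj => hz j (by omega)),
      mul_assoc, mul_assoc, ihg (k' := k' + m)]
    · intro j hj; rw [add_assoc, add_assoc, hs (m + j) (by omega)]
    · intro j hj; rw [add_assoc, add_assoc, hz (m + j) (by omega)]
  | braid m n => exact blockWord_conj hz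
  | sig => exact hs 0 (by omega)
  | sigInv =>
    have := hs 0 (by omega)
    simp only [add_zero] at this
    rw [eval, eval, eq_inv_mul_iff_mul_eq, ← mul_assoc, ← this, mul_inv_cancel_right]

theorem eval_comm {m n m' n' k k' : ℕ} (f : FHom m n) (g : FHom m' n') (h : k + m ≤ k') :
    eval N k f * eval N k' g = eval N k' g * eval N k f := by
  refine eval_conj g (fun j hj => ?_) (fun j hj => ?_) <;>
  refine (eval_conj f (fun i hi => ?_) (fun i hi => ?_)).symm
  · exact VB.sig_comm N _ _ (by omega)
  · exact ((VB.slides_sig N).comm _ _ (by omega)).symm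
  · exact (VB.slides_sig N).comm _ _ (by omega)
  · exact (VB.slides_zet N).comm _ _ (by omega)

/-- The bound `k + m ≤ N` keeps all crossings in range. It cannot be dropped: generators out of
range are `1`, and Yang-Baxter with one of the two generators replaced by `1` would force the other
to be trivial. -/
theorem eval_sound {m n : ℕ} {f g : FHom m n} (h : FEquiv f g) :
    ∀ k, k + m ≤ N → eval N k f = eval N k g := by
  induction h with
  | refl => intros; rfl
  | symm _ ih => exact fun k hk => (ih k hk).symm
  | trans _ _ ih ih' => exact fun k hk => (ih k hk).trans (ih' k hk)
  | @comp _ _ _ f _ _ _ _ _ ih ih' =>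
    obtain rfl := len_eq f
    intro k hk
    rw [eval, eval, ih k hk, ih' k hk]
  | @tensor m _ m' _ f f' g g' _ _ ih ih' =>
    intro k hk
    rw [eval, eval, ih k (by omega), ih' (k + m) (by omega)]
  | id_comp => intros; simp [eval]
  | comp_id => intros; simp [eval]
  | comp_assoc => intros; simp [eval, mul_assoc]
  | tensor_id => intros; simp [eval]
  | tensor_comp f g f' g' =>
    obtain rfl := len_eq f
    intro k hk
    simp only [eval, mul_assoc]
    rw [← mul_assoc (eval N (k + _) g'), ← eval_comm f g' le_rfl, mul_assoc]
  | tensor_assoc => intros; simp [eval, mul_assoc, add_assoc]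
  | unit_tensor => intros; simp [eval]
  | tensor_unit => intros; simp [eval]
  | @braid_natural m n m' n' f g =>
    obtain rfl := len_eq f
    obtain rfl := len_eq g
    intro k hk
    -- The block word shifts `f` up by `m'` and `g` down by `m`; afterwards the two occupy disjoint
    -- strands and may be reordered.
    have hf := eval_conj (N := N) (a := blockWord (VB.zet N) k m m') f (k := k) (k' := k + m')
      (fun j hj => blockWord_up (VB.slides_sig N) (VB.slides_zet N) (VB.zet_sq N) _ _ _ _ hj
        (by omega))
      (fun j hj => blockWord_up (VB.slides_zet N) (VB.slides_zet N) (VB.zet_sq N) _ _ _ _ hj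
        (by omega))
    have hg := eval_conj (N := N) (a := blockWord (VB.zet N) k m m') g (k := k + m) (k' := k)
      (fun j hj => blockWord_down (VB.slides_sig N) _ _ _ _ hj (by omega))
      (fun j hj => blockWord_down (VB.slides_zet N) _ _ _ _ hj (by omega))
    simp only [eval]
    rw [← mul_assoc, hf, mul_assoc, hg, ← mul_assoc, ← eval_comm g f le_rfl]
  | hexagon_forward l m n =>
    intros
    simp [eval, blockWord_add_right (VB.slides_zet N)]
  | hexagon_reverse l m n =>
    intros
    simp [eval, blockWord_add_left]
  | symmetry =>
    intros
    exact blockWord_symm (VB.slides_zet N) (VB.zet_sq N) _ _ _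
  | sig_sigInv => intros; simp [eval]
  | sigInv_sig => intros; simp [eval]
  | yang_baxter =>
    intro k hk
    have := VB.sig_braid N k (by omega)
    simp only [mul_assoc] at this
    simp [eval, this, mul_assoc]

end FHom

/-! ### Formal morphisms acting on consecutive tensor factors -/

namespace C2br

open FHom

theorem len_eq_of_hom {N k l m n : ℕ} (f : FHom m n) (h : N = k + (m + l)) :
    N = k + (n + l) := by
  rw [h, f.len_eq]

/-- The endomorphism `Id^{⊗ k} ⊗ f ⊗ Id^{⊗ l}` of an object of length `k + (m + l)`. -/
def place (X : C2br) (k l : ℕ) {m n : ℕ} (f : FHom m n) (h : X.len = k + (m + l)) : End X :=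
  mk (X := X) (Y := X) ((cast h).comp (((FHom.id k).tensor (f.tensor (FHom.id l))).comp
    (cast (len_eq_of_hom f h).symm)))

variable {X : C2br} {k l : ℕ}

theorem place_sound {m n : ℕ} {f g : FHom m n} (e : FEquiv f g) (h : X.len = k + (m + l)) :
    place X k l f h = place X k l g h :=
  Quotient.sound (.comp (.refl _) (.comp (.tensor (.refl _) (.tensor e (.refl _))) (.refl _)))

/-- Once the length of `X` is literally a sum, both casts are identities. Heterogeneous equality
makes strict associativity usable without tracking them. -/
theorem place_heq {m n : ℕ} (f : FHom m n) (h : X.len = k + (m + l)) :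
    place X k l f h ≍ (𝟙 (of k) ⊗ₘ (mk (X := of m) (Y := of n) f ⊗ₘ 𝟙 (of l))) := by
  obtain ⟨N⟩ := X
  obtain rfl : N = _ := h
  obtain rfl := f.len_eq
  exact heq_of_eq (Quotient.sound ((FEquiv.id_comp _).trans (FEquiv.comp_id _)))

theorem place_cast {m n : ℕ} (e : m = n) (h : X.len = k + (m + l)) :
    place X k l (cast e) h = 1 := by
  subst e
  obtain ⟨N⟩ := X
  obtain rfl : N = _ := h
  exact Quotient.sound ((FEquiv.id_comp _).trans ((FEquiv.comp_id _).trans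
    ((FEquiv.tensor (.refl _) (.tensor_id _ _)).trans (.tensor_id _ _))))

theorem place_comp {m n p : ℕ} (f : FHom m n) (g : FHom n p) (h : X.len = k + (m + l)) :
    place X k l (f.comp g) h = place X k l g (len_eq_of_hom f h) * place X k l f h := by
  obtain rfl := f.len_eq
  obtain rfl := g.len_eq
  apply eq_of_heq
  rw [End.mul_def]
  have hX : X = of k ⊗ (of m ⊗ of l) := congrArg of h
  refine (place_heq _ h).trans (HEq.trans (heq_of_eq ?_)
    (comp_heq' hX hX hX (place_heq f h) (place_heq g h)).symm)
  have e : mk (X := of m) (Y := of m) (f.comp g) =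
    mk (X := of m) (Y := of m) f ≫ mk (X := of m) (Y := of m) g := rfl
  simp [e]

theorem place_tensor_id {m n p : ℕ} (f : FHom m n) (h : X.len = k + (m + p + l)) :
    place X k l (f.tensor (FHom.id p)) h = place X k (p + l) f (by omega) := by
  have A := StrictMonoidal.tensor_assoc (C := C2br)
  apply eq_of_heq
  refine (place_heq _ h).trans (HEq.trans ?_ (place_heq _ _).symm)
  refine tensor_heq rfl rfl (A (of m) (of p) (of l)) (A (of n) (of p) (of l)) HEq.rfl
    ((strict_assoc_nat (mk (X := of m) (Y := of n) f) (𝟙 (of p)) (𝟙 (of l))).trans (heq_of_eq ?_))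
  rw [id_tensorHom_id]
  rfl

theorem place_id_tensor {m n p : ℕ} (f : FHom m n) (h : X.len = k + (p + m + l)) :
    place X k l ((FHom.id p).tensor f) h = place X (k + p) l f (by omega) := by
  have A := StrictMonoidal.tensor_assoc (C := C2br)
  apply eq_of_heq
  refine (place_heq _ h).trans (HEq.trans ?_ (place_heq _ _).symm)
  let F := mk (X := of m) (Y := of n) f
  refine (tensor_heq rfl rfl (A (of p) (of m) (of l)) (A (of p) (of n) (of l)) HEq.rfl
    (strict_assoc_nat (𝟙 (of p)) F (𝟙 (of l)))).trans ?_
  refine (strict_assoc_nat (𝟙 (of k)) (𝟙 (of p)) (F ⊗ₘ 𝟙 (of l))).symm.trans (heq_of_eq ?_)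
  rw [id_tensorHom_id]
  rfl

/-- The interchange law with `f` performed first; `place_tensor'` performs `g` first. -/
theorem place_tensor {m n m' n' : ℕ} (f : FHom m n) (g : FHom m' n')
    (h : X.len = k + (m + m' + l)) :
    place X k l (f.tensor g) h =
      place X (k + m) l g (by omega) * place X k (m' + l) f (by omega) := by
  obtain rfl := f.len_eq
  have e : FEquiv (f.tensor g) ((f.tensor (FHom.id m')).comp ((FHom.id m).tensor g)) :=
    ((FEquiv.tensor_comp _ _ _ _).trans (.tensor (.comp_id f) (.id_comp g))).symm
  rw [place_sound e, place_comp, place_tensor_id, place_id_tensor]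

theorem place_tensor' {m n m' n' : ℕ} (f : FHom m n) (g : FHom m' n')
    (h : X.len = k + (m + m' + l)) :
    place X k l (f.tensor g) h =
      place X k (m' + l) f (by omega) * place X (k + m) l g (by omega) := by
  obtain rfl := g.len_eq
  have e : FEquiv (f.tensor g) (((FHom.id m).tensor g).comp (f.tensor (FHom.id m'))) :=
    ((FEquiv.tensor_comp _ _ _ _).trans (.tensor (.id_comp f) (.comp_id g))).symm
  rw [place_sound e, place_comp, place_tensor_id, place_id_tensor]

/-- With `p` idle strands between the two, both sides are the placement of `(f ⊗ id_p) ⊗ g`,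
factored in the two possible orders. -/
theorem place_comm {m n m' n' k' l' : ℕ} (f : FHom m n) (g : FHom m' n')
    (h : X.len = k + (m + l)) (h' : X.len = k' + (m' + l')) (hk : k + m ≤ k') :
    place X k l f h * place X k' l' g h' = place X k' l' g h' * place X k l f h := by
  obtain ⟨p, rfl⟩ := Nat.exists_eq_add_of_le hk
  obtain rfl : l = p + (m' + l') := by omega
  have e := place_tensor (X := X) (k := k) (l := l') (f.tensor (FHom.id p)) g (by omega)
  rw [place_tensor'] at e
  simpa only [place_tensor_id, add_assoc] using e

/-- The Yang-Baxter equation for the specific braiding at consecutive positions. -/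
theorem place_sig_braid {k' l' : ℕ} (h : X.len = k + (1 + 1 + l))
    (h' : X.len = k' + (1 + 1 + l')) (hk : k' = k + 1) :
    place X k l sig h * place X k' l' sig h' * place X k l sig h =
      place X k' l' sig h' * place X k l sig h * place X k' l' sig h' := by
  subst hk
  obtain rfl : l = 1 + l' := by omega
  have e := place_sound (X := X) (k := k) (l := l') FEquiv.yang_baxter (by omega)
  simpa only [place_comp, place_cast, place_tensor_id, place_id_tensor, one_mul, mul_one] using e

/-- A formal morphism on two strands slides through two symmetric braidings. -/
theorem place_braid_slide {k' l' : ℕ} (f : FHom (1 + 1) (1 + 1)) (h : X.len = k + (1 + 1 + l))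
    (h' : X.len = k' + (1 + 1 + l')) (hk : k' = k + 1) :
    place X k l (braid 1 1) h * place X k' l' (braid 1 1) h' * place X k l f h =
      place X k' l' f h' * place X k l (braid 1 1) h * place X k' l' (braid 1 1) h' := by
  subst hk
  obtain rfl : l = 1 + l' := by omega
  have e := place_sound (X := X) (k := k) (l := l') (FEquiv.hexagon_reverse 1 1 1) (by omega)
  have e' := place_sound (X := X) (k := k) (l := l') (FEquiv.braid_natural f (FHom.id 1))
    (by omega)
  simp only [place_comp, place_cast, place_tensor_id, place_id_tensor, one_mul, mul_one] at e e'
  -- The hexagon `e` splits the braiding of two strands past one into two elementary crossings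
  -- inside the naturality square `e'`.
  rw [e] at e'
  simpa only [mul_assoc] using e'

theorem place_mul_eq_one {m n : ℕ} {f : FHom m n} {g : FHom n m}
    (e : FEquiv (f.comp g) (FHom.id m)) (h : X.len = k + (m + l)) :
    place X k l g (len_eq_of_hom f h) * place X k l f h = 1 := by
  rw [← place_comp, place_sound e, place_cast]

/-! ### Comparison of virtual braids and endomorphisms -/

theorem len_eq_of_fin {N : ℕ} (hX : X.len = N) (i : Fin (N - 1)) :
    X.len = i + (1 + 1 + (N - i - 2)) := by
  have := i.isLt
  omega

/-- The automorphism of an object of length `N` given by a generator of `VB N`. -/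
def genUnit (X : C2br) {N : ℕ} (hX : X.len = N) : Gen N → (End X)ˣ
  | .σ i =>
    { val := place X i (N - i - 2) sig (len_eq_of_fin hX i)
      inv := place X i (N - i - 2) sigInv (len_eq_of_fin hX i)
      val_inv := place_mul_eq_one FEquiv.sigInv_sig _
      inv_val := place_mul_eq_one FEquiv.sig_sigInv _ }
  | .ζ i =>
    { val := place X i (N - i - 2) (braid 1 1) (len_eq_of_fin hX i)
      inv := place X i (N - i - 2) (braid 1 1) (len_eq_of_fin hX i)
      val_inv := place_mul_eq_one (FEquiv.symmetry 1 1) _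
      inv_val := place_mul_eq_one (FEquiv.symmetry 1 1) _ }

theorem place_comm_of_one_lt_abs {N : ℕ} (hX : X.len = N) (f g : FHom (1 + 1) (1 + 1))
    (i j : Fin (N - 1)) (h : 1 < |(i : ℤ) - (j : ℤ)|) :
    place X i (N - i - 2) f (len_eq_of_fin hX i) * place X j (N - j - 2) g (len_eq_of_fin hX j) =
      place X j (N - j - 2) g (len_eq_of_fin hX j) *
        place X i (N - i - 2) f (len_eq_of_fin hX i) := by
  rw [lt_abs] at h
  rcases h with h | h
  · exact (place_comm g f _ _ (by omega)).symm
  · exact place_comm f g _ _ (by omega)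

theorem lift_genUnit_rel {N : ℕ} (hX : X.len = N) {a b : FreeGroup (Gen N)} (h : Rel N a b) :
    FreeGroup.lift (genUnit X hX) a = FreeGroup.lift (genUnit X hX) b := by
  apply Units.ext
  cases h <;> simp only [map_mul, FreeGroup.lift_apply_of, Units.val_mul, genUnit, map_one]
  case σ_comm i j h => exact place_comm_of_one_lt_abs hX _ _ i j h
  case ζ_comm i j h => exact place_comm_of_one_lt_abs hX _ _ i j h
  case mixed_comm i j h => exact place_comm_of_one_lt_abs hX _ _ i j h
  case σ_yb i j h => exact place_sig_braid _ _ h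
  case ζ_yb i j h => exact place_braid_slide _ _ _ h
  case mixed_yb i j h => exact place_braid_slide _ _ _ h
  case ζ_sq i => exact place_mul_eq_one (FEquiv.symmetry 1 1) _

theorem lift_genUnit_eq_one {N : ℕ} (hX : X.len = N) :
    ∀ w ∈ {w : FreeGroup (Gen N) | ∃ a b, Rel N a b ∧ w = a * b⁻¹},
      FreeGroup.lift (genUnit X hX) w = 1 := by
  rintro _ ⟨a, b, h, rfl⟩
  rw [map_mul, map_inv, lift_genUnit_rel hX h, mul_inv_cancel]

/-- The endomorphism represented by a virtual braid. -/
def ofBraid (X : C2br) {N : ℕ} (hX : X.len = N) : VB N →* End X :=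
  (Units.coeHom (End X)).comp (PresentedGroup.toGroup (lift_genUnit_eq_one hX))

theorem ofBraid_σ {N : ℕ} (hX : X.len = N) (i : Fin (N - 1)) :
    ofBraid X hX (VB.σ i) = place X i (N - i - 2) sig (len_eq_of_fin hX i) :=
  congrArg Units.val (PresentedGroup.toGroup.of (lift_genUnit_eq_one hX) (x := Gen.σ i))

theorem ofBraid_ζ {N : ℕ} (hX : X.len = N) (i : Fin (N - 1)) :
    ofBraid X hX (VB.ζ i) = place X i (N - i - 2) (braid 1 1) (len_eq_of_fin hX i) :=
  congrArg Units.val (PresentedGroup.toGroup.of (lift_genUnit_eq_one hX) (x := Gen.ζ i))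

theorem ofBraid_σ_inv {N : ℕ} (hX : X.len = N) (i : Fin (N - 1)) :
    ofBraid X hX (VB.σ i)⁻¹ = place X i (N - i - 2) sigInv (len_eq_of_fin hX i) := by
  have e : ofBraid X hX (VB.σ i)⁻¹ * ofBraid X hX (VB.σ i) = 1 := by
    rw [← map_mul, inv_mul_cancel, map_one]
  rw [ofBraid_σ] at e
  exact left_inv_eq_right_inv e (place_mul_eq_one FEquiv.sigInv_sig _)

/-- The virtual braid represented by an endomorphism. -/
def toBraid (X : C2br) {N : ℕ} (hX : X.len = N) : End X →* VB N where
  toFun f := Quotient.lift (fun p : FHom X.len X.len => p.eval N 0)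
    (fun _ _ h => eval_sound h 0 (by omega)) f
  map_one' := rfl
  map_mul' := by rintro ⟨f⟩ ⟨g⟩; rfl

theorem toBraid_place {N : ℕ} (hX : X.len = N) {m n : ℕ} (f : FHom m n)
    (h : X.len = k + (m + l)) : toBraid X hX (place X k l f h) = f.eval N k := by
  change FHom.eval N 0 _ = _
  simp [FHom.eval]

/-- Both sides are homomorphisms in `v`, so generators suffice. -/
theorem toBraid_ofBraid {N : ℕ} (hX : X.len = N) (v : VB N) :
    toBraid X hX (ofBraid X hX v) = v := by
  refine DFunLike.congr_fun (f := (toBraid X hX).comp (ofBraid X hX)) (g := MonoidHom.id _)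
    (PresentedGroup.ext fun x => ?_) v
  cases x with
  | σ i =>
    refine (congrArg (toBraid X hX) (ofBraid_σ hX i)).trans ((toBraid_place _ _ _).trans ?_)
    exact VB.sig_of_lt i.isLt
  | ζ i =>
    refine (congrArg (toBraid X hX) (ofBraid_ζ hX i)).trans ((toBraid_place _ _ _).trans ?_)
    -- The block word for `c_{1,1}` unfolds to `1 * (ζ * 1)`.
    exact (one_mul _).trans ((mul_one _).trans (VB.zet_of_lt i.isLt))

/-! ### Surjectivity: every endomorphism comes from a virtual braid -/

/-- All placements of `f` in `X` are represented by virtual braids. -/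
def IsBraid (X : C2br) {N : ℕ} (hX : X.len = N) {m n : ℕ} (f : FHom m n) : Prop :=
  ∀ k l (h : X.len = k + (m + l)), place X k l f h ∈ MonoidHom.mrange (ofBraid X hX)

namespace IsBraid

variable {N : ℕ} {hX : X.len = N}

theorem congr {m n : ℕ} {f g : FHom m n} (e : FEquiv f g) (hg : IsBraid X hX g) :
    IsBraid X hX f := fun k l h => by
  rw [place_sound e]; exact hg k l h

theorem cast {m n : ℕ} (e : m = n) : IsBraid X hX (FHom.cast e) := fun k l h => by
  rw [place_cast]; exact one_mem _

theorem comp {m n p : ℕ} {f : FHom m n} {g : FHom n p} (hf : IsBraid X hX f)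
    (hg : IsBraid X hX g) : IsBraid X hX (f.comp g) := fun k l h => by
  rw [place_comp]; exact mul_mem (hg _ _ _) (hf _ _ _)

theorem tensor {m n m' n' : ℕ} {f : FHom m n} {g : FHom m' n'} (hf : IsBraid X hX f)
    (hg : IsBraid X hX g) : IsBraid X hX (f.tensor g) := fun k l h => by
  rw [place_tensor]; exact mul_mem (hg _ _ _) (hf _ _ _)

theorem sig : IsBraid X hX FHom.sig := fun k l h => by
  obtain rfl : l = N - k - 2 := by omega
  exact ⟨_, ofBraid_σ hX ⟨k, by omega⟩⟩

theorem sigInv : IsBraid X hX FHom.sigInv := fun k l h => by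
  obtain rfl : l = N - k - 2 := by omega
  exact ⟨_, ofBraid_σ_inv hX ⟨k, by omega⟩⟩

theorem braid_one_one : IsBraid X hX (FHom.braid 1 1) := fun k l h => by
  obtain rfl : l = N - k - 2 := by omega
  exact ⟨_, ofBraid_ζ hX ⟨k, by omega⟩⟩

theorem of_cast_comp_cast {m n m' n' : ℕ} {e : m' = m} {e' : n = n'} {f : FHom m n}
    (h : IsBraid X hX ((FHom.cast e).comp (f.comp (FHom.cast e')))) : IsBraid X hX f := by
  subst e e'
  exact congr ((FEquiv.id_comp _).trans (.comp_id _)).symm h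

/-- Braiding with the unit is an identity by coherence. The equality is derived among morphisms of
`C2br`, then `Quotient.exact` returns it to formal morphisms. -/
theorem braid_zero_left (n : ℕ) : IsBraid X hX (FHom.braid 0 n) := by
  have e := braiding_tensorUnit_left (of n)
  rw [StrictMonoidal.leftUnitor_eq, StrictMonoidal.rightUnitor_eq] at e
  simp only [eqToIso.hom, eqToIso.inv, eqToHom_trans] at e
  rw [← mk_cast] at e
  exact congr (Quotient.exact e) (cast _)

theorem braid_zero_right (n : ℕ) : IsBraid X hX (FHom.braid n 0) := by
  have e := braiding_tensorUnit_right (of n)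
  rw [StrictMonoidal.leftUnitor_eq, StrictMonoidal.rightUnitor_eq] at e
  simp only [eqToIso.hom, eqToIso.inv, eqToHom_trans] at e
  rw [← mk_cast] at e
  exact congr (Quotient.exact e) (cast _)

/-- The forward hexagon peels off the last of the `n + 1` strands that are crossed. -/
theorem braid_one_left : ∀ n : ℕ, IsBraid X hX (FHom.braid 1 n)
  | 0 => braid_zero_right 1
  | n + 1 => of_cast_comp_cast (congr (FEquiv.hexagon_forward 1 n 1)
      (((braid_one_left n).tensor (cast _)).comp ((cast _).comp ((cast _).tensor braid_one_one))))

/-- The reverse hexagon peels off one strand of the first block. -/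
theorem braid (n : ℕ) : ∀ m : ℕ, IsBraid X hX (FHom.braid m n)
  | 0 => braid_zero_left n
  | m + 1 => of_cast_comp_cast (congr (FEquiv.hexagon_reverse m 1 n)
      (((cast _).tensor (braid_one_left n)).comp ((cast _).comp ((braid n m).tensor (cast _)))))

theorem all {m n : ℕ} (f : FHom m n) : IsBraid X hX f := by
  induction f with
  | cast => exact cast _
  | comp _ _ ihf ihg => exact ihf.comp ihg
  | tensor _ _ ihf ihg => exact ihf.tensor ihg
  | braid m n => exact braid n m
  | sig => exact sig
  | sigInv => exact sigInv

end IsBraid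

theorem place_zero_zero (f : FHom X.len X.len) :
    place X 0 0 f (by omega) = mk (X := X) (Y := X) f := by
  apply eq_of_heq
  refine (place_heq _ _).trans ((strict_unit_tensor _).trans (strict_tensor_unit _))

theorem ofBraid_bijective {N : ℕ} (hX : X.len = N) : Function.Bijective (ofBraid X hX) := by
  refine ⟨Function.LeftInverse.injective (toBraid_ofBraid hX), ?_⟩
  rintro ⟨f⟩
  -- With no strands on either side, the placement of `f` is `f` itself.
  have := IsBraid.all (hX := hX) f 0 0 (by omega)
  rw [place_zero_zero] at this
  exact this

/-- The length of a tensor power at a variable exponent is known only by induction, which is why the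
comparison maps take an arbitrary `X` with a proof of `X.len = N`. -/
theorem tensorPow_gen_len (n : ℕ) : (tensorPow gen.V n).len = n := by
  induction n with
  | zero => rfl
  | succ n ih => exact congrArg (· + 1) ih

/-- Stating this for arbitrary `A` and `B` of the right lengths allows `k` and `l` to be substituted
away, which is impossible for the tensor powers themselves. -/
theorem eqToHom_comp_place {X A B : C2br} {f : FHom (1 + 1) (1 + 1)}
    (hA : A.len = k) (hB : B.len = l)
    (e : X = A ⊗ ((gen.V ⊗ gen.V) ⊗ B)) (h : X.len = k + (1 + 1 + l)) :
    eqToHom e ≫ (𝟙 A ⊗ₘ (mk (X := gen.V ⊗ gen.V) (Y := gen.V ⊗ gen.V) f ⊗ₘ 𝟙 B)) ≫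
      eqToHom e.symm = place X k l f h := by
  subst hA hB
  exact eq_of_heq ((sandwich_heq _ _ _).trans (place_heq f h).symm)

theorem insertAt_mk (f : FHom (1 + 1) (1 + 1)) {n : ℕ} (i : Fin (n - 1)) :
    insertAt (V := gen.V) (mk (X := gen.V ⊗ gen.V) (Y := gen.V ⊗ gen.V) f) i =
      place (tensorPow gen.V n) i (n - i - 2) f (len_eq_of_fin (tensorPow_gen_len n) i) :=
  eqToHom_comp_place (tensorPow_gen_len _) (tensorPow_gen_len _) _ _

end C2br
end VirtualBraid

open VirtualBraid in
/-- `C2br` is the free (strict) symmetric category on the braided object `C2br.gen = (V, σ_V)`, and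
for every `n` the assignment `ζ_i ↦ c_i`, `σ_i^{±1} ↦ (σ_V^{±1})_i` is a group isomorphism
`VB_n ≅ End (V^{⊗ n})`. -/
theorem mainTheorem1 :
    IsFreeOn.{0, 0, u, v} C2br C2br.gen ∧
    ∀ n : ℕ, ∃ ψ : VB n ≃* End (tensorPow C2br.gen.V n),
      (∀ i : Fin (n - 1), ψ (VB.ζ i) = insertAt (β_ C2br.gen.V C2br.gen.V).hom i) ∧
      (∀ i : Fin (n - 1), ψ (VB.σ i) = insertAt C2br.gen.σ.hom i) ∧
      (∀ i : Fin (n - 1), ψ ((VB.σ i)⁻¹) = insertAt C2br.gen.σ.inv i) := by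
  refine ⟨C2br.isFreeOn_gen, fun n => ?_⟩
  have hX := C2br.tensorPow_gen_len n
  exact ⟨MulEquiv.ofBijective _ (C2br.ofBraid_bijective hX),
    fun i => (C2br.ofBraid_ζ hX i).trans (C2br.insertAt_mk _ i).symm,
    fun i => (C2br.ofBraid_σ hX i).trans (C2br.insertAt_mk _ i).symm,
    fun i => (C2br.ofBraid_σ_inv hX i).trans (C2br.insertAt_mk _ i).symm⟩
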